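/- Let $d\ge 0$ be an integer and let $V_\omega=\{V_\omega(x): x\in\mathbb Z^d\}$ be independent, identically distributed real random variables on a probability space $(\Omega,\mathcal F,\mathbb P)$ whose common distribution has a bounded density $\rho$. The Anderson Hamiltonian is the random self-adjoint operator $H_\omega=-\Delta+V_\omega$ on $\ell^2(\mathbb Z^d)$, where $(\Delta\varphi)(x)=\sum_{y\in\mathbb Z^d,\ |x-y|=1}\varphi(y)$ ($|\cdot|$ the Euclidean norm) and $(V_\omega\varphi)(x)=V_\omega(x)\varphi(x)$, with domain $\{\varphi\in\ell^2(\mathbb Z^d): V_\omega\varphi\in\ell^2(\mathbb Z^d)\}$. An interval $I\subset\mathbb R$ is called an interval of exponential localization for $H_\omega$ if, with probability one, $H_\omega$ has pure point spectrum in $I$ (the restriction to $I$ of each of its spectral measures is pure point) and every eigenfunction $\varphi$ of $H_\omega$ with eigenvalue in $I$ decays exponentially, i.e. $|\varphi(x)|\le C e^{-\kappa|x|}$ for all $x\in\mathbb Z^d$, with some constants $C<\infty$ and $\kappa>0$ that may depend on $\omega$ and $\varphi$. Let $I$ be an interval of exponential localization for the Anderson Hamiltonian $H_\omega$. Then, with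 probability one, every eigenvalue of $H_\omega$ in $I$ is simple, i.e. its eigenspace is one-dimensional. -/

import Mathlib

open MeasureTheory ProbabilityTheory

noncomputable section

namespace Anderson

/-- The lattice `ℤ^d`. -/
abbrev Lattice (d : ℕ) : Type := Fin d → ℤ

/-- The Hilbert space `ℓ²(ℤ^d)` of complex-valued functions. -/
abbrev Ell2 (d : ℕ) : Type := lp (fun _ : Lattice d => ℂ) 2

/-- The Euclidean norm `|x|` of a lattice point. -/
def latticeNorm {d : ℕ} (x : Lattice d) : ℝ := Real.sqrt (∑ i, (x i : ℝ) ^ 2)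

/-- The discrete Laplacian `(Δ f)(x) = ∑_{|x - y| = 1} f(y)`: the points at distance one from `x`
are exactly `x + e_i` and `x - e_i`, where `e_i` runs over the standard basis. -/
def laplacian {d : ℕ} (f : Lattice d → ℂ) (x : Lattice d) : ℂ :=
  ∑ i : Fin d, (f (x + Pi.single i 1) + f (x - Pi.single i 1))

theorem memℓp_comp_injective {d : ℕ} {f : Lattice d → ℂ} (hf : Memℓp f 2)
    {e : Lattice d → Lattice d} (he : Function.Injective e) : Memℓp (fun x => f (e x)) 2 := by
  have h2 : 0 < (2 : ENNReal).toReal := by norm_num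
  rw [memℓp_gen_iff h2] at hf ⊢
  exact hf.comp_injective he

theorem memℓp_laplacian {d : ℕ} {f : Lattice d → ℂ} (hf : Memℓp f 2) :
    Memℓp (laplacian f) 2 := by
  have h : Memℓp (fun x : Lattice d => ∑ i ∈ (Finset.univ : Finset (Fin d)),
      (f (x + Pi.single i 1) + f (x - Pi.single i 1))) 2 := by
    refine Memℓp.finsetSum (E := fun _ : Lattice d => ℂ) Finset.univ
      (f := fun (i : Fin d) (x : Lattice d) => f (x + Pi.single i 1) + f (x - Pi.single i 1)) ?_
    intro i _
    exact (memℓp_comp_injective hf (add_left_injective _)).add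
      (memℓp_comp_injective hf (sub_left_injective))
  exact h

/-- The Schrödinger operator `H = -Δ + v` on `ℓ²(ℤ^d)` with real potential `v`. As `v` may be
unbounded, this is an unbounded operator, with its natural domain
`{φ ∈ ℓ²(ℤ^d) : v φ ∈ ℓ²(ℤ^d)}`. -/
def hamiltonian {d : ℕ} (v : Lattice d → ℝ) : Ell2 d →ₗ.[ℂ] Ell2 d where
  domain :=
    { carrier := {φ | Memℓp (fun x => (v x : ℂ) * φ x) 2}
      zero_mem' := by
        have h : (fun x => (v x : ℂ) * (0 : Ell2 d) x) = (0 : Lattice d → ℂ) := by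
          funext x; simp
        change Memℓp (fun x => (v x : ℂ) * (0 : Ell2 d) x) 2
        rw [h]
        exact zero_memℓp
      add_mem' := by
        intro φ ψ hφ hψ
        have h : (fun x => (v x : ℂ) * (φ + ψ) x)
            = (fun x => (v x : ℂ) * φ x) + (fun x => (v x : ℂ) * ψ x) := by
          funext x; simp [mul_add]
        change Memℓp (fun x => (v x : ℂ) * (φ + ψ) x) 2
        rw [h]
        exact Memℓp.add hφ hψ
      smul_mem' := by
        intro c φ hφ
        have h : (fun x => (v x : ℂ) * (c • φ) x) = c • (fun x => (v x : ℂ) * φ x) := by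
          funext x; simp [mul_left_comm]
        change Memℓp (fun x => (v x : ℂ) * (c • φ) x) 2
        rw [h]
        exact Memℓp.const_smul hφ c }
  toFun :=
    { toFun := fun φ => ⟨fun x => -laplacian (φ : Ell2 d) x + (v x : ℂ) * (φ : Ell2 d) x,
        ((memℓp_laplacian (lp.memℓp (φ : Ell2 d))).neg).add φ.2⟩
      map_add' := by
        intro φ ψ
        ext x
        simp only [Submodule.coe_add, lp.coeFn_add, Pi.add_apply, laplacian,
          Finset.sum_add_distrib]
        ring
      map_smul' := by
        intro c φ
        ext x
        simp only [Submodule.coe_smul, lp.coeFn_smul, Pi.smul_apply, laplacian, smul_eq_mul,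
          RingHom.id_apply, ← mul_add, ← Finset.mul_sum]
        ring }

section Operators

variable {𝓗 : Type*} [NormedAddCommGroup 𝓗] [InnerProductSpace ℂ 𝓗]

/-- The eigenspace `{φ ∈ D(H) : H φ = E φ}` of an unbounded operator `H`. -/
def eigenspace (H : 𝓗 →ₗ.[ℂ] 𝓗) (E : ℝ) : Submodule ℂ 𝓗 where
  carrier := {φ | ∃ h : φ ∈ H.domain, H ⟨φ, h⟩ = (E : ℂ) • φ}
  zero_mem' := ⟨H.domain.zero_mem, by
    have h : (⟨0, H.domain.zero_mem⟩ : H.domain) = 0 := rfl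
    rw [h, LinearPMap.map_zero, smul_zero]⟩
  add_mem' := by
    rintro φ ψ ⟨hφ, eφ⟩ ⟨hψ, eψ⟩
    refine ⟨H.domain.add_mem hφ hψ, ?_⟩
    have h : (⟨φ + ψ, H.domain.add_mem hφ hψ⟩ : H.domain) = ⟨φ, hφ⟩ + ⟨ψ, hψ⟩ := rfl
    rw [h, LinearPMap.map_add, eφ, eψ, smul_add]
  smul_mem' := by
    rintro c φ ⟨hφ, eφ⟩
    refine ⟨H.domain.smul_mem c hφ, ?_⟩
    have h : (⟨c • φ, H.domain.smul_mem c hφ⟩ : H.domain) = c • ⟨φ, hφ⟩ := rfl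
    rw [h, LinearPMap.map_smul, eφ, smul_comm]

/-- `φ` is an eigenfunction of `H` with eigenvalue `E`. -/
def IsEigenfunction (H : 𝓗 →ₗ.[ℂ] 𝓗) (E : ℝ) (φ : 𝓗) : Prop :=
  φ ∈ eigenspace H E ∧ φ ≠ 0

/-- `E` is an eigenvalue of `H`. -/
def IsEigenvalue (H : 𝓗 →ₗ.[ℂ] 𝓗) (E : ℝ) : Prop :=
  ∃ φ, IsEigenfunction H E φ

/-- `E` is a simple eigenvalue of `H`: its eigenspace is one-dimensional. -/
def IsSimpleEigenvalue (H : 𝓗 →ₗ.[ℂ] 𝓗) (E : ℝ) : Prop :=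
  Module.finrank ℂ (eigenspace H E) = 1

/-- `m` is the spectral measure of the self-adjoint operator `H` at the vector `φ`, that is, the
finite Borel measure on `ℝ` with `⟨φ, (H - z)⁻¹ φ⟩ = ∫ (t - z)⁻¹ dm(t)` for all non-real `z`.
(By the spectral theorem there is exactly one for every `φ`.) -/
def IsSpectralMeasure (H : 𝓗 →ₗ.[ℂ] 𝓗) (φ : 𝓗) (m : Measure ℝ) : Prop :=
  IsFiniteMeasure m ∧ ∀ z : ℂ, z.im ≠ 0 →
    ∃ ψ : H.domain, H ψ - z • (ψ : 𝓗) = φ ∧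
      inner ℂ φ (ψ : 𝓗) = ∫ t : ℝ, ((t : ℂ) - z)⁻¹ ∂m

/-- `H` has pure point spectrum in `I`: all its spectral measures are pure point in `I`, that is,
their restrictions to `I` are carried by countable sets. -/
def HasPurePointSpectrumIn (H : 𝓗 →ₗ.[ℂ] 𝓗) (I : Set ℝ) : Prop :=
  ∀ (φ : 𝓗) (m : Measure ℝ), IsSpectralMeasure H φ m →
    ∃ S : Set ℝ, S.Countable ∧ m (I \ S) = 0

end Operators

/-- `φ` decays exponentially. The constants may depend on `φ`. -/
def DecaysExponentially {d : ℕ} (φ : Lattice d → ℂ) : Prop :=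
  ∃ C κ : ℝ, 0 < κ ∧ ∀ x, ‖φ x‖ ≤ C * Real.exp (-κ * latticeNorm x)

/-- `V` is the random potential of an Anderson model: the `V x`, `x ∈ ℤ^d`, are independent
random variables with a common distribution which has the bounded density `ρ`. -/
structure IsAndersonPotential {Ω : Type*} [MeasurableSpace Ω] {d : ℕ} (P : Measure Ω)
    (V : Lattice d → Ω → ℝ) (ρ : ℝ → ℝ) : Prop where
  measurable : ∀ x, Measurable (V x)
  indep : iIndepFun V P
  density_measurable : Measurable ρ
  density_nonneg : ∀ t, 0 ≤ ρ t
  density_bounded : ∃ M : ℝ, ∀ t, ρ t ≤ M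
  law : ∀ x, P.map (V x) = (volume : Measure ℝ).withDensity (fun t => ENNReal.ofReal (ρ t))

/-- The Anderson Hamiltonian `H_ω = -Δ + V_ω`. -/
def andersonHamiltonian {Ω : Type*} {d : ℕ} (V : Lattice d → Ω → ℝ) (ω : Ω) :
    Ell2 d →ₗ.[ℂ] Ell2 d :=
  hamiltonian (fun x => V x ω)

/-- `I` is an interval of exponential localization: with probability one, `H_ω` has pure point
spectrum in `I`, and every eigenfunction of `H_ω` with eigenvalue in `I` decays exponentially. -/
def IsIntervalOfExponentialLocalization {Ω : Type*} [MeasurableSpace Ω] {d : ℕ} (P : Measure Ω)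
    (V : Lattice d → Ω → ℝ) (I : Set ℝ) : Prop :=
  I.OrdConnected ∧ ∀ᵐ ω ∂P,
    HasPurePointSpectrumIn (andersonHamiltonian V ω) I ∧
    ∀ E ∈ I, ∀ φ : Ell2 d, IsEigenfunction (andersonHamiltonian V ω) E φ → DecaysExponentially φ

end Anderson

end

/-!
A degenerate eigenvalue forces a codimension-one constraint on the values of the potential at a pair
of sites, and these values have an absolutely continuous joint law.

If `E` is an eigenvalue of `H_v = -Δ + v` which is not simple, then there are two sites `x ≠ y` and
eigenfunctions `w`, `u` with `w x = 1`, `w y = 0` and `u x = 0`, `u y = 1`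
(`exists_normalized_of_not_simple`). Fix all values of `v` except those at `x` and `y`. If `v` and
`v'` both have such eigenfunctions, at energies `E` and `E'`, then the symmetry of `-Δ` gives
`v x - v' x = (E - E') ⟪w', w⟫` and `v y - v' y = (E - E') ⟪u', u⟫`
(`IsNormalizedSolution.abs_sub_le`). So, as long as the norms of the eigenfunctions are bounded by
`N`, the pair `(v x, v y)` is an `N²`-Lipschitz function of the energy. The set of these pairs thus
has Hausdorff dimension at most one, and is a null set of the plane (`volume_slice_eq_zero`).

For fixed `x`, `y` and `N` the set of potentials with such a pair of eigenfunctions is closed in the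
topology of pointwise convergence, by compactness of the set of admissible `(E, w, u)`
(`isClosed_degenerateSet`). It is hence measurable, and Fubini's theorem shows that it has
probability zero. A countable union over `x`, `y` and `N` concludes.
-/

open Set

open scoped NNReal ENNReal InnerProductSpace

namespace Anderson

variable {d : ℕ}

/-! ### Solutions of the eigenvalue equation -/

/-- `w` is a square-summable solution of `(-Δ + v) w = E w`, of `ℓ²`-norm at most `N`, with
`w x = 1` and `w y = 0`. The condition on the norm is written with finite sums, so that it is
visibly closed under pointwise convergence of `w`. -/
structure IsNormalizedSolution (N : ℝ) (x y : Lattice d) (v : Lattice d → ℝ) (E : ℝ)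
    (w : Lattice d → ℂ) : Prop where
  sum_le : ∀ F : Finset (Lattice d), ∑ z ∈ F, ‖w z‖ ^ 2 ≤ N ^ 2
  eqn : ∀ z, -laplacian w z + (v z : ℂ) * w z = (E : ℂ) * w z
  one : w x = 1
  zero : w y = 0

theorem sub_apply (f g : Ell2 d) (z : Lattice d) : (f - g) z = f z - g z := rfl

theorem smul_apply (c : ℂ) (f : Ell2 d) (z : Lattice d) : (c • f) z = c * f z := rfl

theorem exists_ell2_of_sum_le {N : ℝ} (hN : 0 ≤ N) {w : Lattice d → ℂ}
    (h : ∀ F : Finset (Lattice d), ∑ z ∈ F, ‖w z‖ ^ 2 ≤ N ^ 2) :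
    ∃ φ : Ell2 d, (φ : Lattice d → ℂ) = w ∧ ‖φ‖ ≤ N := by
  have h' : ∀ F : Finset (Lattice d), ∑ z ∈ F, ‖w z‖ ^ (2 : ℝ≥0∞).toReal ≤
      N ^ (2 : ℝ≥0∞).toReal := by
    intro F
    simpa using h F
  exact ⟨⟨w, memℓp_gen' h'⟩, rfl, lp.norm_le_of_forall_sum_le (by norm_num) hN h'⟩

theorem sum_norm_sq_le (φ : Ell2 d) (F : Finset (Lattice d)) :
    ∑ z ∈ F, ‖φ z‖ ^ 2 ≤ ‖φ‖ ^ 2 := by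
  simpa using lp.sum_rpow_le_norm_rpow (p := 2) (by norm_num) φ F

/-- Symmetry of the Laplacian: the Wronskian-type density of two `ℓ²` functions sums to zero. -/
theorem hasSum_laplacian_sub (φ ψ : Ell2 d) :
    HasSum (fun z => starRingEnd ℂ (ψ z) * laplacian φ z -
      starRingEnd ℂ (laplacian ψ z) * φ z) 0 := by
  have hs : ∀ (f g : Ell2 d) (e : Lattice d),
      Summable fun z => starRingEnd ℂ (f z) * g (z + e) := by
    intro f g e
    have := lp.summable_inner (𝕜 := ℂ) f
      (⟨fun z => g (z + e), memℓp_comp_injective (lp.memℓp g) (add_left_injective e)⟩ : Ell2 d)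
    refine this.congr fun z => ?_
    simp [RCLike.inner_apply, mul_comm]
  have key : ∀ e : Lattice d, HasSum (fun z => starRingEnd ℂ (ψ z) * φ (z + e) -
      starRingEnd ℂ (ψ (z - e)) * φ z) 0 := by
    intro e
    have h1 := (hs ψ φ e).hasSum
    have h2 := (Equiv.subRight e).hasSum_iff.mpr h1
    have h3 := h1.sub h2
    rw [sub_self] at h3
    refine h3.congr_fun fun z => ?_
    simp
  have h := hasSum_sum (s := (Finset.univ : Finset (Fin d))) fun i _ =>
    (key (Pi.single i 1)).add (key (-Pi.single i 1))
  simp only [add_zero, Finset.sum_const_zero] at h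
  refine h.congr_fun fun z => ?_
  simp only [laplacian, map_sum, map_add, Finset.mul_sum, Finset.sum_mul,
    ← Finset.sum_sub_distrib]
  refine Finset.sum_congr rfl fun i _ => ?_
  rw [← sub_eq_add_neg, sub_neg_eq_add]
  ring

/-- Two potentials which differ at `x` and `y` only, and which have solutions `w`, `w'` normalized
at `x` and vanishing at `y`, satisfy `v x - v' x = (E - E') ⟪w', w⟫`;
the Cauchy-Schwarz inequality gives the bound. -/
theorem IsNormalizedSolution.abs_sub_le {N : ℝ} (hN : 0 ≤ N) {x y : Lattice d}
    {v v' : Lattice d → ℝ} {E E' : ℝ} {w w' : Lattice d → ℂ}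
    (hw : IsNormalizedSolution N x y v E w) (hw' : IsNormalizedSolution N x y v' E' w')
    (hv : ∀ z, z ≠ x → z ≠ y → v z = v' z) :
    |v x - v' x| ≤ N ^ 2 * |E - E'| := by
  obtain ⟨φ, rfl, hφ⟩ := exists_ell2_of_sum_le hN hw.sum_le
  obtain ⟨ψ, rfl, hψ⟩ := exists_ell2_of_sum_le hN hw'.sum_le
  have h1 := (lp.hasSum_inner (𝕜 := ℂ) ψ φ).mul_left ((E : ℂ) - E')
  have h2 := h1.add (hasSum_laplacian_sub φ ψ)
  rw [add_zero] at h2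
  have h3 : HasSum (fun z => ((E : ℂ) - E') * ⟪ψ z, φ z⟫_ℂ +
      (starRingEnd ℂ (ψ z) * laplacian φ z - starRingEnd ℂ (laplacian ψ z) * φ z))
      ((v x : ℂ) - v' x) := by
    have hz : ∀ z, ((E : ℂ) - E') * ⟪ψ z, φ z⟫_ℂ +
        (starRingEnd ℂ (ψ z) * laplacian φ z - starRingEnd ℂ (laplacian ψ z) * φ z) =
        ((v z : ℂ) - v' z) * (starRingEnd ℂ (ψ z) * φ z) := by
      intro z
      have e1 := hw.eqn z
      have e2 := congrArg (starRingEnd ℂ) (hw'.eqn z)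
      simp only [map_add, map_neg, map_mul, Complex.conj_ofReal] at e2
      simp only [RCLike.inner_apply]
      linear_combination (-starRingEnd ℂ (ψ z)) * e1 + φ z * e2
    simp only [hz]
    have := hasSum_single (f := fun z => ((v z : ℂ) - v' z) * (starRingEnd ℂ (ψ z) * φ z)) x ?_
    · simpa [hw.one, hw'.one] using this
    · intro z hzx
      by_cases hzy : z = y
      · simp [hzy, hw.zero]
      · simp [hv z hzx hzy]
  have h4 : ((v x : ℂ) - v' x) = ((E : ℂ) - E') * ⟪ψ, φ⟫_ℂ := h3.unique h2
  have h5 : |v x - v' x| = |E - E'| * ‖⟪ψ, φ⟫_ℂ‖ := by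
    have := congrArg norm h4
    rwa [norm_mul, ← Complex.ofReal_sub, ← Complex.ofReal_sub, Complex.norm_real,
      Complex.norm_real, Real.norm_eq_abs, Real.norm_eq_abs] at this
  rw [h5, mul_comm]
  refine mul_le_mul_of_nonneg_right ?_ (abs_nonneg _)
  calc ‖⟪ψ, φ⟫_ℂ‖ ≤ ‖ψ‖ * ‖φ‖ := norm_inner_le_norm _ _
    _ ≤ N * N := mul_le_mul hψ hφ (norm_nonneg _) hN
    _ = N ^ 2 := (sq N).symm

/-! ### The set of degenerate potentials -/

/-- The potentials `v` for which `-Δ + v` has, at some energy in `[-N, N]`, two `ℓ²` solutions of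
norm at most `N` whose values at the pair `(x, y)` are `(1, 0)` and `(0, 1)`. -/
def degenerateSet (N : ℝ) (x y : Lattice d) : Set (Lattice d → ℝ) :=
  {v | ∃ (E : ℝ) (w u : Lattice d → ℂ), |E| ≤ N ∧
    IsNormalizedSolution N x y v E w ∧ IsNormalizedSolution N y x v E u}

/-- The condition on `(E, w, v)` is closed for the topology of pointwise convergence. -/
theorem isClosed_setOf_isNormalizedSolution (N : ℝ) (x y : Lattice d) :
    IsClosed {p : (ℝ × (Lattice d → ℂ)) × (Lattice d → ℝ) |
      IsNormalizedSolution N x y p.2 p.1.1 p.1.2} := by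
  have h : {p : (ℝ × (Lattice d → ℂ)) × (Lattice d → ℝ) |
      IsNormalizedSolution N x y p.2 p.1.1 p.1.2} =
      (⋂ F : Finset (Lattice d), {p | ∑ z ∈ F, ‖p.1.2 z‖ ^ 2 ≤ N ^ 2}) ∩
      (⋂ z, {p | -laplacian p.1.2 z + (p.2 z : ℂ) * p.1.2 z = (p.1.1 : ℂ) * p.1.2 z}) ∩
      ({p | p.1.2 x = 1} ∩ {p | p.1.2 y = 0}) := by
    ext p
    simp only [mem_ofPred_eq, mem_inter_iff, mem_iInter]
    exact ⟨fun h => ⟨⟨h.sum_le, h.eqn⟩, h.one, h.zero⟩, fun h => ⟨h.1.1, h.1.2, h.2.1, h.2.2⟩⟩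
  rw [h]
  refine ((isClosed_iInter fun F => ?_).inter (isClosed_iInter fun z => ?_)).inter
    (IsClosed.inter ?_ ?_)
  · exact isClosed_le (by fun_prop) continuous_const
  · unfold laplacian
    exact isClosed_eq (by fun_prop) (by fun_prop)
  · exact isClosed_eq (by fun_prop) continuous_const
  · exact isClosed_eq (by fun_prop) continuous_const

/-- The degenerate set is the projection of a closed set along a compact space of triples
`(E, w, u)`. -/
theorem isClosed_degenerateSet {N : ℝ} (hN : 0 ≤ N) (x y : Lattice d) :
    IsClosed (degenerateSet N x y) := by
  let B : Set (Lattice d → ℂ) := univ.pi fun _ => Metric.closedBall 0 N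
  have hB : IsCompact B := isCompact_univ_pi fun _ => isCompact_closedBall _ _
  let K : Set (ℝ × (Lattice d → ℂ) × (Lattice d → ℂ)) := Metric.closedBall 0 N ×ˢ (B ×ˢ B)
  have hK : IsCompact K := (isCompact_closedBall _ _).prod (hB.prod hB)
  have hmem : ∀ {x y : Lattice d} {v E w}, IsNormalizedSolution N x y v E w → w ∈ B := by
    intro x y v E w hw z _
    have := hw.sum_le {z}
    rw [Finset.sum_singleton] at this
    simpa using abs_le_of_sq_le_sq' this hN |>.2
  have : CompactSpace K := isCompact_iff_compactSpace.mp hK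
  let T : Set (K × (Lattice d → ℝ)) := {p |
    IsNormalizedSolution N x y p.2 p.1.1.1 p.1.1.2.1 ∧
    IsNormalizedSolution N y x p.2 p.1.1.1 p.1.1.2.2}
  have hT : IsClosed T := by
    refine IsClosed.inter ?_ ?_
    · exact (isClosed_setOf_isNormalizedSolution N x y).preimage
        (f := fun p : K × (Lattice d → ℝ) => ((p.1.1.1, p.1.1.2.1), p.2)) (by fun_prop)
    · exact (isClosed_setOf_isNormalizedSolution N y x).preimage
        (f := fun p : K × (Lattice d → ℝ) => ((p.1.1.1, p.1.1.2.2), p.2)) (by fun_prop)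
  have h : degenerateSet N x y = Prod.snd '' T := by
    ext v
    constructor
    · rintro ⟨E, w, u, hE, hw, hu⟩
      exact ⟨(⟨(E, w, u), by simpa using hE, hmem hw, hmem hu⟩, v), ⟨hw, hu⟩, rfl⟩
    · rintro ⟨⟨⟨⟨E, w, u⟩, hE, hwu⟩, v⟩, ⟨hw, hu⟩, rfl⟩
      exact ⟨E, w, u, by simpa using hE, hw, hu⟩
  rw [h]
  exact isClosedMap_snd_of_compactSpace _ hT

/-! ### Slices of the degenerate set -/

/-- A set of points in the plane which are Lipschitz functions of a real parameter is a null set. -/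
theorem volume_eq_zero_of_dist_le {S : Set (ℝ × ℝ)} (C : ℝ≥0) (e : ℝ × ℝ → ℝ)
    (h : ∀ p ∈ S, ∀ q ∈ S, dist p q ≤ C * dist (e p) (e q)) : volume S = 0 := by
  have ha : AntilipschitzWith C fun p : S => e p :=
    AntilipschitzWith.of_le_mul_dist fun p q => h p p.2 q q.2
  have h1 : dimH S ≤ 1 := by
    calc dimH S = dimH (Subtype.val '' (univ : Set S)) := by rw [image_univ, Subtype.range_coe]
      _ = dimH (univ : Set S) := isometry_subtype_coe.dimH_image _
      _ ≤ dimH ((fun p : S => e p) '' univ) := ha.le_dimH_image _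
      _ ≤ dimH (univ : Set ℝ) := dimH_mono (subset_univ _)
      _ = 1 := Real.dimH_univ
  have h2 : dimH S < (2 : ℝ≥0) := h1.trans_lt (by norm_num)
  have h3 := hausdorffMeasure_of_dimH_lt h2
  rwa [NNReal.coe_ofNat, hausdorffMeasure_prod_real] at h3

/-- The potential with values `p.1` at `x`, `p.2` at `y`, and those of `r` elsewhere. -/
def setPair (x y : Lattice d) (r : Lattice d → ℝ) (p : ℝ × ℝ) : Lattice d → ℝ :=
  fun z => if z = x then p.1 else if z = y then p.2 else r z

theorem measurable_setPair (x y : Lattice d) :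
    Measurable fun q : (Lattice d → ℝ) × (ℝ × ℝ) => setPair x y q.1 q.2 := by
  refine measurable_pi_lambda _ fun z => ?_
  unfold setPair
  split_ifs <;> fun_prop

/-- For fixed values at the other sites, the degenerate pairs `(v x, v y)` form a null set. -/
theorem volume_slice_eq_zero {N : ℝ≥0} {x y : Lattice d} (hxy : x ≠ y) (r : Lattice d → ℝ) :
    volume (setPair x y r ⁻¹' degenerateSet N x y) = 0 := by
  choose! e w u _ hw hu using
    fun (p : ℝ × ℝ) (hp : p ∈ setPair x y r ⁻¹' degenerateSet N x y) => hp
  refine volume_eq_zero_of_dist_le (N ^ 2) e fun p hp q hq => ?_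
  have h1 := (hw p hp).abs_sub_le N.2 (hw q hq) fun z hx hy => by simp [setPair, hx, hy]
  have h2 := (hu p hp).abs_sub_le N.2 (hu q hq) fun z hx hy => by simp [setPair, hx, hy]
  simp only [setPair, if_true, if_neg hxy.symm] at h1 h2
  rw [Prod.dist_eq]
  exact max_le (by simpa [Real.dist_eq] using h1) (by simpa [Real.dist_eq] using h2)

/-! ### Probability -/

/-- The values of the potential at `x` and `y` are independent of its values at all other sites,
encoded as the potential with the values at `x` and `y` replaced by zero. -/
theorem IsAndersonPotential.indepFun_pair {Ω : Type*} [MeasurableSpace Ω] {P : Measure Ω}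
    {V : Lattice d → Ω → ℝ} {ρ : ℝ → ℝ} (hV : IsAndersonPotential P V ρ) (x y : Lattice d) :
    IndepFun (fun ω => setPair x y (fun z => V z ω) (0, 0)) (fun ω => (V x ω, V y ω)) P := by
  have h := indep_iSup_of_disjoint (fun z => (hV.measurable z).comap_le) hV.indep
    (disjoint_compl_left (a := ({x, y} : Set (Lattice d))))
  rw [IndepFun_iff_Indep]
  have hle : ∀ (S : Set (Lattice d)) z, z ∈ S →
      Measurable[⨆ i ∈ S, MeasurableSpace.comap (V i) inferInstance] (V z) := fun S z hz =>
    (comap_measurable (V z)).mono (le_iSup₂_of_le z hz le_rfl) le_rfl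
  refine indep_of_indep_of_le_left (indep_of_indep_of_le_right h ?_) ?_
  · exact ((hle _ x (by simp)).prodMk (hle _ y (by simp))).comap_le
  · refine Measurable.comap_le (@measurable_pi_lambda _ _ _ (_) _ _ fun z => ?_)
    unfold setPair
    split_ifs with hx hy
    · exact measurable_const
    · exact measurable_const
    · exact hle _ z (by simp [hx, hy])

/-- The joint law of the potential at two sites is absolutely continuous. -/
theorem IsAndersonPotential.map_pair_absolutelyContinuous {Ω : Type*} [MeasurableSpace Ω]
    {P : Measure Ω} [IsProbabilityMeasure P] {V : Lattice d → Ω → ℝ} {ρ : ℝ → ℝ}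
    (hV : IsAndersonPotential P V ρ) {x y : Lattice d} (hxy : x ≠ y) :
    P.map (fun ω => (V x ω, V y ω)) ≪ volume := by
  have hac : ∀ z, P.map (V z) ≪ volume := fun z => by
    rw [hV.law z]
    exact withDensity_absolutelyContinuous _ _
  rw [(indepFun_iff_map_prod_eq_prod_map_map (hV.measurable x).aemeasurable
    (hV.measurable y).aemeasurable).mp (hV.indep.indepFun hxy), Measure.volume_eq_prod]
  exact (hac x).prod (hac y)

/-- Fubini's theorem, applied to the pair of values at `x` and `y` and the remaining values. -/
theorem IsAndersonPotential.ae_notMem_degenerateSet {Ω : Type*} [MeasurableSpace Ω]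
    {P : Measure Ω} [IsProbabilityMeasure P] {V : Lattice d → Ω → ℝ} {ρ : ℝ → ℝ}
    (hV : IsAndersonPotential P V ρ) {x y : Lattice d} (hxy : x ≠ y) (N : ℝ≥0) :
    ∀ᵐ ω ∂P, (fun z => V z ω) ∉ degenerateSet N x y := by
  have hVm : Measurable fun ω z => V z ω := measurable_pi_lambda _ hV.measurable
  have hR : Measurable fun ω => setPair x y (fun z => V z ω) (0, 0) :=
    (measurable_setPair x y).comp (hVm.prodMk measurable_const)
  have hpair : Measurable fun ω => (V x ω, V y ω) := (hV.measurable x).prodMk (hV.measurable y)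
  have hD : MeasurableSet ((fun q : (Lattice d → ℝ) × (ℝ × ℝ) => setPair x y q.1 q.2) ⁻¹'
      degenerateSet N x y) :=
    measurable_setPair x y (isClosed_degenerateSet N.2 x y).measurableSet
  have h0 : P.map (fun ω => (setPair x y (fun z => V z ω) (0, 0), (V x ω, V y ω)))
      ((fun q : (Lattice d → ℝ) × (ℝ × ℝ) => setPair x y q.1 q.2) ⁻¹'
        degenerateSet N x y) = 0 := by
    rw [(indepFun_iff_map_prod_eq_prod_map_map hR.aemeasurable hpair.aemeasurable).mp
      (hV.indepFun_pair x y), Measure.measure_prod_null hD]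
    exact Filter.Eventually.of_forall fun r =>
      hV.map_pair_absolutelyContinuous hxy (volume_slice_eq_zero hxy r)
  rw [Measure.map_apply (hR.prodMk hpair) hD] at h0
  rw [ae_iff]
  refine measure_mono_null (fun ω hω => ?_) h0
  have hω' : (fun z => V z ω) ∈ degenerateSet N x y := not_not.mp hω
  have he : setPair x y (setPair x y (fun z => V z ω) (0, 0)) (V x ω, V y ω) =
      fun z => V z ω := by
    funext z
    unfold setPair
    split_ifs with hx hy
    · rw [hx]
    · rw [hy]
    · rfl
  change setPair x y (setPair x y (fun z => V z ω) (0, 0)) (V x ω, V y ω) ∈ degenerateSet N x y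
  rwa [he]

/-! ### Eigenvalues which are not simple -/

theorem eqn_of_mem_eigenspace {v : Lattice d → ℝ} {E : ℝ} {φ : Ell2 d}
    (h : φ ∈ eigenspace (hamiltonian v) E) (z : Lattice d) :
    -laplacian φ z + (v z : ℂ) * φ z = (E : ℂ) * φ z := by
  obtain ⟨hd, he⟩ := h
  have := congrArg (fun f : Ell2 d => f z) he
  exact this

theorem isNormalizedSolution_of_mem_eigenspace {v : Lattice d → ℝ} {E N : ℝ} {φ : Ell2 d}
    (h : φ ∈ eigenspace (hamiltonian v) E) (hN : ‖φ‖ ≤ N) {x y : Lattice d} (hx : φ x = 1)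
    (hy : φ y = 0) : IsNormalizedSolution N x y v E φ where
  sum_le F := (sum_norm_sq_le φ F).trans (pow_le_pow_left₀ (norm_nonneg _) hN 2)
  eqn := eqn_of_mem_eigenspace h
  one := hx
  zero := hy

/-- In a space of functions of dimension other than zero and one, two functions can be found which
take the values `(1, 0)` and `(0, 1)` at some pair of points. -/
theorem exists_normalized_of_not_simple {W : Submodule ℂ (Ell2 d)} {φ : Ell2 d} (hφ : φ ∈ W)
    (h0 : φ ≠ 0) (hW : Module.finrank ℂ W ≠ 1) :
    ∃ (x y : Lattice d) (w u : Ell2 d), w ∈ W ∧ u ∈ W ∧ w x = 1 ∧ w y = 0 ∧ u y = 1 ∧ u x = 0 := by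
  have hne : ∀ f : Ell2 d, f ≠ 0 → ∃ z, f z ≠ 0 := by
    intro f hf
    by_contra! hcon
    exact hf (lp.ext (funext hcon))
  obtain ⟨x, hx⟩ := hne φ h0
  -- A function of the space which vanishes at `x` but not identically; without one, every
  -- function of the space would be determined by its value at `x`.
  obtain ⟨ψ, hψ, hψx, hψ0⟩ : ∃ ψ ∈ W, ψ x = 0 ∧ ψ ≠ 0 := by
    by_contra! hcon
    refine hW (finrank_eq_one_iff'.mpr ⟨⟨φ, hφ⟩, by simpa using h0, fun f => ⟨f.1 x / φ x, ?_⟩⟩)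
    have := hcon ((f.1 x / φ x) • φ - f.1) (W.sub_mem (W.smul_mem _ hφ) f.2)
      (by rw [sub_apply, smul_apply, div_mul_cancel₀ _ hx, sub_self])
    exact Subtype.ext (sub_eq_zero.mp this)
  obtain ⟨y, hy⟩ := hne ψ hψ0
  refine ⟨x, y, (φ x)⁻¹ • (φ - (φ y / ψ y) • ψ), (ψ y)⁻¹ • ψ,
    W.smul_mem _ (W.sub_mem hφ (W.smul_mem _ hψ)), W.smul_mem _ hψ, ?_, ?_, ?_, ?_⟩
  · rw [smul_apply, sub_apply, smul_apply, hψx, mul_zero, sub_zero, inv_mul_cancel₀ hx]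
  · rw [smul_apply, sub_apply, smul_apply, div_mul_cancel₀ _ hy, sub_self, mul_zero]
  · rw [smul_apply, inv_mul_cancel₀ hy]
  · rw [smul_apply, hψx, mul_zero]

end Anderson

theorem mainTheorem2 {Ω : Type*} [MeasurableSpace Ω] (P : Measure Ω) [IsProbabilityMeasure P]
    (d : ℕ) (V : Anderson.Lattice d → Ω → ℝ) (ρ : ℝ → ℝ)
    (hV : Anderson.IsAndersonPotential P V ρ)
    (I : Set ℝ) (hI : Anderson.IsIntervalOfExponentialLocalization P V I) :
    ∀ᵐ ω ∂P, ∀ E ∈ I, Anderson.IsEigenvalue (Anderson.andersonHamiltonian V ω) E →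
      Anderson.IsSimpleEigenvalue (Anderson.andersonHamiltonian V ω) E := by
  have hae : ∀ᵐ ω ∂P, ∀ (x y : Anderson.Lattice d) (N : ℕ), x ≠ y →
      (fun z => V z ω) ∉ Anderson.degenerateSet ((N : ℝ≥0) : ℝ) x y := by
    refine ae_all_iff.mpr fun x => ae_all_iff.mpr fun y => ae_all_iff.mpr fun N => ?_
    by_cases hxy : x = y
    · exact Filter.Eventually.of_forall fun ω h => absurd hxy h
    · filter_upwards [hV.ae_notMem_degenerateSet hxy N] with ω hω _ using hω
  filter_upwards [hae] with ω hω E _ ⟨φ, hφ, hφ0⟩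
  by_contra hs
  obtain ⟨x, y, w, u, hw, hu, hwx, hwy, huy, hux⟩ :=
    Anderson.exists_normalized_of_not_simple hφ hφ0 hs
  obtain ⟨N, hN⟩ := exists_nat_ge (max |E| (max ‖w‖ ‖u‖))
  simp only [max_le_iff] at hN
  have hxy : x ≠ y := by
    rintro rfl
    exact one_ne_zero (hwx.symm.trans hwy)
  exact hω x y N hxy ⟨E, w, u, by simpa using hN.1,
    Anderson.isNormalizedSolution_of_mem_eigenspace hw (by simpa using hN.2.1) hwx hwy,
    Anderson.isNormalizedSolution_of_mem_eigenspace hu (by simpa using hN.2.2) huy hux⟩
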